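/- Let $\mathcal H$ be a complex Hilbert space and let $B$, $C$ be (in general unbounded) linear operators in $\mathcal H$ with domains $\mathcal D(B)$, $\mathcal D(C)$. Products, sums and inverses of operators carry their natural domains; in particular $\mathcal D(B^2)=\{x\in\mathcal D(B): Bx\in\mathcal D(B)\}$ and $\mathcal D(B^2+C)=\mathcal D(B^2)\cap\mathcal D(C)$. An operator $T$ is called accretive if $\operatorname{Re}\langle Tx,x\rangle\ge 0$ for all $x\in\mathcal D(T)$, and m-accretive if it is accretive, densely defined, and $\mathcal R(\lambda+T)=\mathcal H$ for some (equivalently, every) $\lambda>0$. It is called boundedly invertible if it is a bijection of $\mathcal D(T)$ onto $\mathcal H$ whose inverse is a bounded operator on $\mathcal H$. **Proposition 3.1.** Let $B^2$ be m-accretive and let $C$ be accretive. Suppose that one of the following conditions holds: - (C.1) $\mathcal D(B^2)\subset\mathcal D(C)$ and there exist $\alpha\ge 0$, $0\le\beta<1$ and $\delta\ge 0$ such that $\operatorname{Re}\langle B^2x,Cx\rangle\ge-\alpha\|x\|^2-\beta\|B^2x\|^2-\delta\|B^2x\|\,\|x\|$ for all $x\in\mathcal D(B^2)$; - (C.2)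 $\mathcal D(B^2)\subset\mathcal D(C)$ and there exist $a\ge 0$ and $0\le b<1$ such that $\|Cx\|^2\le a\|x\|^2+b\|B^2x\|^2$ for all $x\in\mathcal D(B^2)$; - (C.3) $I+C(B^2+t_0)^{-1}$ is boundedly invertible for some $t_0>0$; - (C.4) $B$ is accretive and $\mathcal D(B)\subset\mathcal D(C)$; - (C.5) $B$ is accretive and $C$ is a bounded operator defined on all of $\mathcal H$. Then $\Lambda=B^2+C$ is m-accretive. Moreover, its domain is $\mathcal D(B^2)$ if (C.1), (C.2), (C.4) or (C.5) holds, and also under (C.3) whenever $\mathcal D(B^2)\subset\mathcal D(C)$. -/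

import Mathlib

namespace AccretivePencil

variable {H : Type*} [NormedAddCommGroup H] [InnerProductSpace ℂ H]

/-- The product `S T` of two (unbounded) operators, with its natural domain
`{x ∈ D(T) : T x ∈ D(S)}`. -/
def mul (S T : H →ₗ.[ℂ] H) : H →ₗ.[ℂ] H where
  domain :=
    { carrier := {x | ∃ h : x ∈ T.domain, T ⟨x, h⟩ ∈ S.domain}
      zero_mem' := ⟨T.domain.zero_mem, by
        have h : T ⟨0, T.domain.zero_mem⟩ = 0 := T.map_zero
        rw [h]; exact S.domain.zero_mem⟩
      add_mem' := by
        rintro x y ⟨hx, hx'⟩ ⟨hy, hy'⟩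
        refine ⟨T.domain.add_mem hx hy, ?_⟩
        have h : T ⟨x + y, T.domain.add_mem hx hy⟩ = T ⟨x, hx⟩ + T ⟨y, hy⟩ :=
          T.map_add ⟨x, hx⟩ ⟨y, hy⟩
        rw [h]; exact S.domain.add_mem hx' hy'
      smul_mem' := by
        rintro c x ⟨hx, hx'⟩
        refine ⟨T.domain.smul_mem c hx, ?_⟩
        have h : T ⟨c • x, T.domain.smul_mem c hx⟩ = c • T ⟨x, hx⟩ := T.map_smul c ⟨x, hx⟩
        rw [h]; exact S.domain.smul_mem c hx' }
  toFun :=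
    { toFun := fun x => S ⟨T ⟨x, x.2.1⟩, x.2.2⟩
      map_add' := by
        rintro ⟨x, hx, hx'⟩ ⟨y, hy, hy'⟩
        rw [← S.map_add]
        congr 1
        exact Subtype.ext (T.map_add ⟨x, hx⟩ ⟨y, hy⟩)
      map_smul' := by
        rintro c ⟨x, hx, hx'⟩
        rw [RingHom.id_apply, ← S.map_smul]
        congr 1
        exact Subtype.ext (T.map_smul c ⟨x, hx⟩) }

/-- The square `B²`, with domain `{x ∈ D(B) : B x ∈ D(B)}`. -/
def sq (B : H →ₗ.[ℂ] H) : H →ₗ.[ℂ] H := mul B B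

/-- The operator `c I + T`, with domain `D(T)`. -/
def shift (c : ℂ) (T : H →ₗ.[ℂ] H) : H →ₗ.[ℂ] H :=
  (c • (LinearMap.id : H →ₗ[ℂ] H)) +ᵥ T

/-- `T` is accretive: `Re ⟨T x, x⟩ ≥ 0` for all `x ∈ D(T)`. -/
def IsAccretive (T : H →ₗ.[ℂ] H) : Prop :=
  ∀ x : T.domain, 0 ≤ (inner ℂ (T x) (x : H)).re

/-- `T` is m-accretive: it is accretive, densely defined, and `R(l + T) = H` for some `l > 0`
(the condition then holds for every `l > 0`). -/
def IsMAccretive (T : H →ₗ.[ℂ] H) : Prop :=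
  IsAccretive T ∧ Dense (T.domain : Set H) ∧
    ∃ l : ℝ, 0 < l ∧ Function.Surjective (shift (l : ℂ) T)

/-- `T` is boundedly invertible: it maps `D(T)` bijectively onto `H`, and its inverse is a bounded
operator on `H`. -/
def IsBoundedlyInvertible (T : H →ₗ.[ℂ] H) : Prop :=
  ∃ R : H →L[ℂ] H, (∀ y : H, ∃ h : R y ∈ T.domain, T ⟨R y, h⟩ = y) ∧
    ∀ x : T.domain, R (T x) = x

/-- (C.1): `D(B²) ⊆ D(C)` and
`Re ⟨B² x, C x⟩ ≥ -α ‖x‖² - β ‖B² x‖² - δ ‖B² x‖ ‖x‖` on `D(B²)`. -/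
def CondC1 (B C : H →ₗ.[ℂ] H) : Prop :=
  ∃ hBC : (sq B).domain ≤ C.domain, ∃ α β δ : ℝ, 0 ≤ α ∧ 0 ≤ β ∧ β < 1 ∧ 0 ≤ δ ∧
    ∀ x : (sq B).domain,
      - α * ‖(x : H)‖ ^ 2 - β * ‖sq B x‖ ^ 2 - δ * ‖sq B x‖ * ‖(x : H)‖
        ≤ (inner ℂ (sq B x) (C ⟨x, hBC x.2⟩)).re

/-- (C.2): `D(B²) ⊆ D(C)` and `‖C x‖² ≤ a ‖x‖² + b ‖B² x‖²` on `D(B²)`, with `b < 1`. -/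
def CondC2 (B C : H →ₗ.[ℂ] H) : Prop :=
  ∃ hBC : (sq B).domain ≤ C.domain, ∃ a b : ℝ, 0 ≤ a ∧ 0 ≤ b ∧ b < 1 ∧
    ∀ x : (sq B).domain,
      ‖C ⟨x, hBC x.2⟩‖ ^ 2 ≤ a * ‖(x : H)‖ ^ 2 + b * ‖sq B x‖ ^ 2

/-- (C.3): `I + C (B² + t₀)⁻¹`, on its natural domain, is boundedly invertible for some `t₀ > 0`.
(When `B²` is accretive, `B² + t₀` is injective, so that `LinearPMap.inverse` is its inverse.) -/
def CondC3 (B C : H →ₗ.[ℂ] H) : Prop :=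
  ∃ t₀ : ℝ, 0 < t₀ ∧
    IsBoundedlyInvertible (shift 1 (mul C (shift (t₀ : ℂ) (sq B)).inverse))

/-- (C.4): `B` is accretive and `D(B) ⊆ D(C)`. -/
def CondC4 (B C : H →ₗ.[ℂ] H) : Prop :=
  IsAccretive B ∧ B.domain ≤ C.domain

/-- (C.5): `B` is accretive and `C` is a bounded operator on `H`. -/
def CondC5 (B C : H →ₗ.[ℂ] H) : Prop :=
  IsAccretive B ∧ C.domain = ⊤ ∧ ∃ M : ℝ, ∀ x : C.domain, ‖C x‖ ≤ M * ‖(x : H)‖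

end AccretivePencil

namespace AccretivePencil

open Filter Topology

variable {H : Type*} [NormedAddCommGroup H] [InnerProductSpace ℂ H]

/-! A sum of accretive operators is accretive, and in a Hilbert space accretivity together with
surjectivity of `l + T` forces a dense domain. Only surjectivity of some `l + B² + C` is therefore
at stake.

Under `CondC1` it is carried along the path `1 + B² + tC`, `0 ≤ t ≤ 1`. Closability and the closed
graph theorem bound `C` relative to `B²`, and the inner product condition bounds `‖B²x‖` by `‖x +
B²x + tCx‖` uniformly in `t` (`IsMAccretive.add_of_inner_ge`).

`CondC2`, `CondC4` and `CondC5` all give `‖Cx‖ ≤ δ‖x‖ + β‖B²x‖` with `β < 1`, hence `CondC1` by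
Cauchy–Schwarz. Under `CondC3`, `t₀ + B² + C = (I + C(B² + t₀)⁻¹)(B² + t₀)` is onto. -/

theorem sq_domain_le (B : H →ₗ.[ℂ] H) : (sq B).domain ≤ B.domain :=
  fun _ hx => hx.1

theorem IsAccretive.add {S T : H →ₗ.[ℂ] H} (hS : IsAccretive S) (hT : IsAccretive T) :
    IsAccretive (S + T) := by
  rintro ⟨x, hxS, hxT⟩
  have h : (S + T) ⟨x, hxS, hxT⟩ = S ⟨x, hxS⟩ + T ⟨x, hxT⟩ := rfl
  rw [h, inner_add_left, Complex.add_re]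
  exact add_nonneg (hS ⟨x, hxS⟩) (hT ⟨x, hxT⟩)

/-- An element `x` with `0 ≤ Re ⟨y, x⟩` satisfies `l ‖x‖ ≤ ‖l x + y‖`. -/
theorem mul_norm_le_of_inner_nonneg {x y : H} (h : 0 ≤ (inner ℂ y x).re) (l : ℝ) :
    l * ‖x‖ ≤ ‖(l : ℂ) • x + y‖ := by
  have h1 : l * ‖x‖ ^ 2 ≤ (inner ℂ ((l : ℂ) • x + y) x).re := by
    rw [inner_add_left, inner_smul_left, Complex.conj_ofReal, inner_self_eq_norm_sq_to_K,
      Complex.add_re]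
    have : ((l : ℂ) * ((‖x‖ : ℝ) : ℂ) ^ 2).re = l * ‖x‖ ^ 2 := by
      rw [← Complex.ofReal_pow, ← Complex.ofReal_mul, Complex.ofReal_re]
    change l * ‖x‖ ^ 2 ≤ ((l : ℂ) * ((‖x‖ : ℝ) : ℂ) ^ 2).re + _
    rw [this]
    linarith
  have h2 := (Complex.re_le_norm _).trans (norm_inner_le_norm (𝕜 := ℂ) ((l : ℂ) • x + y) x)
  rcases (norm_nonneg x).eq_or_lt with hx | hx
  · rw [← hx]; simp
  · refine le_of_mul_le_mul_right ?_ hx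
    nlinarith

/-- A densely defined accretive operator is closable. -/
theorem IsAccretive.eq_zero_of_tendsto {T : H →ₗ.[ℂ] H} (hT : IsAccretive T)
    (hd : Dense (T.domain : Set H)) {x : ℕ → T.domain} {z : H}
    (hx : Tendsto (fun n => (x n : H)) atTop (𝓝 0)) (hz : Tendsto (fun n => T (x n)) atTop (𝓝 z)) :
    z = 0 := by
  have h1 : ∀ w : T.domain, 0 ≤ (inner ℂ (z + T w) (w : H)).re := by
    intro w
    have hlim : Tendsto (fun n => (inner ℂ (T (x n) + T w) ((x n : H) + w)).re) atTop
        (𝓝 (inner ℂ (z + T w) (0 + (w : H))).re) :=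
      (Complex.continuous_re.tendsto _).comp ((hz.add_const _).inner (hx.add_const _))
    rw [zero_add] at hlim
    refine ge_of_tendsto' hlim fun n => ?_
    have := hT (x n + w)
    rwa [T.map_add] at this
  have h2 : ∀ w : T.domain, 0 ≤ (inner ℂ z (w : H)).re := by
    intro w
    set p := (inner ℂ z (w : H)).re with hp
    set q := (inner ℂ (T w) (w : H)).re with hq
    have hq0 : 0 ≤ q := hT w
    -- Scaling `w` by `t` makes the `T w` term quadratic in `t`, so it is negligible for small `t`.
    have key : ∀ t : ℝ, 0 < t → 0 ≤ p + t * q := by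
      intro t ht
      have := h1 ((t : ℂ) • w)
      rw [T.map_smul, Submodule.coe_smul, inner_add_left, inner_smul_right, inner_smul_left,
        inner_smul_right, Complex.conj_ofReal, Complex.add_re, Complex.re_ofReal_mul,
        Complex.re_ofReal_mul, Complex.re_ofReal_mul, ← hp, ← hq, ← mul_add] at this
      exact nonneg_of_mul_nonneg_right this ht
    by_contra! hneg
    have ht : 0 < -p / (2 * (q + 1)) := div_pos (by linarith) (by linarith)
    have h3 := key _ ht
    have h4 : -p / (2 * (q + 1)) * (q + 1) = -p / 2 := by field_simp
    nlinarith
  have h3 : ∀ w : H, 0 ≤ (inner ℂ z w).re := by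
    have hcl : IsClosed {w : H | 0 ≤ (inner ℂ z w).re} :=
      isClosed_le continuous_const (Complex.continuous_re.comp (by fun_prop))
    intro w
    exact hcl.closure_subset_iff.mpr (fun v hv => h2 ⟨v, hv⟩) (hd w)
  have h4 := h3 (-z)
  rw [inner_neg_right, Complex.neg_re] at h4
  have h5 : (inner ℂ z z).re = ‖z‖ ^ 2 := (norm_sq_eq_re_inner (𝕜 := ℂ) z).symm
  rw [h5] at h4
  have : ‖z‖ = 0 := by nlinarith [norm_nonneg z]
  exact norm_eq_zero.mp this

/-- If `v < u`, then `u v + w v² ≤ (1 + w) u v`, and dividing by `(1 - β) u` gives the first term.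
The extra `+ v` covers `u ≤ v`. -/
theorem le_of_sq_le {u v w β : ℝ} (hu : 0 ≤ u) (hv : 0 ≤ v) (hw : 0 ≤ w) (hβ : β < 1)
    (h : (1 - β) * u ^ 2 ≤ u * v + w * v ^ 2) : u ≤ (1 + w) / (1 - β) * v + v := by
  have h1 : 0 < 1 - β := by linarith
  by_contra! hlt
  have h2 : v < u := by
    have : 0 ≤ (1 + w) / (1 - β) * v := by positivity
    linarith
  have h3 : (1 + w) * v + (1 - β) * v < (1 - β) * u := by
    have := mul_lt_mul_of_pos_left hlt h1
    have e : (1 - β) * ((1 + w) / (1 - β) * v + v) = (1 + w) * v + (1 - β) * v := by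
      field_simp
    linarith
  nlinarith [mul_nonneg hw hv, mul_nonneg h1.le hv, mul_nonneg (mul_nonneg hw hv) (sub_nonneg.mpr h2.le)]

theorem condC1_of_norm_le {B C : H →ₗ.[ℂ] H} (hBC : (sq B).domain ≤ C.domain) {β δ : ℝ}
    (hβ0 : 0 ≤ β) (hβ : β < 1) (hδ : 0 ≤ δ)
    (h : ∀ x : (sq B).domain, ‖C ⟨x, hBC x.2⟩‖ ≤ δ * ‖(x : H)‖ + β * ‖sq B x‖) :
    CondC1 B C := by
  refine ⟨hBC, 0, β, δ, le_rfl, hβ0, hβ, hδ, fun x => ?_⟩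
  have h1 := (Complex.abs_re_le_norm _).trans
    (norm_inner_le_norm (𝕜 := ℂ) (sq B x) (C ⟨x, hBC x.2⟩))
  have h2 := mul_le_mul_of_nonneg_left (h x) (norm_nonneg (sq B x))
  have h3 := (abs_le.mp h1).1
  linarith

theorem CondC2.condC1 {B C : H →ₗ.[ℂ] H} (h : CondC2 B C) : CondC1 B C := by
  obtain ⟨hBC, a, b, ha, hb0, hb, h⟩ := h
  refine condC1_of_norm_le hBC (Real.sqrt_nonneg b) ((Real.sqrt_lt' one_pos).mpr (by simpa))
    (Real.sqrt_nonneg a) fun x => ?_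
  refine abs_le_of_sq_le_sq' ?_ (by positivity) |>.2
  refine (h x).trans ?_
  have h1 := Real.sq_sqrt ha
  have h2 := Real.sq_sqrt hb0
  have h3 : 0 ≤ √a * ‖(x : H)‖ * (√b * ‖sq B x‖) := by positivity
  nlinarith

/-- For accretive `B` with `B²` accretive, `B` has relative bound zero with respect to `B²`. -/
theorem IsAccretive.mul_norm_le {B : H →ₗ.[ℂ] H} (hB : IsAccretive B) (hB2 : IsAccretive (sq B))
    {s : ℝ} (hs : 0 < s) (x : (sq B).domain) :
    s * ‖B ⟨x, x.2.1⟩‖ ≤ ‖sq B x‖ + s ^ 2 * ‖(x : H)‖ := by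
  obtain ⟨x, hx, hx'⟩ := x
  set u : B.domain := ⟨x, hx⟩ with hu
  set w : B.domain := ⟨B u, hx'⟩ with hw
  change s * ‖B u‖ ≤ ‖B w‖ + s ^ 2 * ‖x‖
  -- Accretivity of `B` is tested on `Bx - s x`; the term `-s Re ⟨B²x, x⟩` is nonpositive and can be
  -- dropped.
  have h1 := hB (w - (s : ℂ) • u)
  have h2 : 0 ≤ (inner ℂ (B w) x).re := hB2 ⟨x, hx, hx'⟩
  rw [B.map_sub, B.map_smul, Submodule.coe_sub, Submodule.coe_smul] at h1
  change 0 ≤ (inner ℂ (B w - (s : ℂ) • B u) (B u - (s : ℂ) • x)).re at h1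
  rw [inner_sub_left, inner_sub_right, inner_sub_right, inner_smul_left, inner_smul_left,
    inner_smul_right, inner_smul_right, Complex.conj_ofReal] at h1
  simp only [Complex.sub_re, Complex.re_ofReal_mul] at h1
  have h3 : (inner ℂ (B u) (B u)).re = ‖B u‖ ^ 2 := (norm_sq_eq_re_inner (𝕜 := ℂ) (B u)).symm
  have h4 := (Complex.re_le_norm _).trans (norm_inner_le_norm (𝕜 := ℂ) (B w) (B u))
  have h5 := (Complex.re_le_norm _).trans (norm_inner_le_norm (𝕜 := ℂ) (B u) x)
  rw [h3] at h1
  have h6 := mul_nonneg hs.le h2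
  have h7 := mul_le_mul_of_nonneg_left h5 (mul_nonneg hs.le hs.le)
  rcases (norm_nonneg (B u)).eq_or_lt with h0 | h0
  · rw [← h0, mul_zero]; positivity
  · refine le_of_mul_le_mul_right ?_ h0
    nlinarith

theorem CondC5.condC1 {B C : H →ₗ.[ℂ] H} (h : CondC5 B C) : CondC1 B C := by
  obtain ⟨-, hC, M, hM⟩ := h
  refine condC1_of_norm_le (hC ▸ le_top) le_rfl one_pos (abs_nonneg M) fun x => ?_
  rw [zero_mul, add_zero]
  exact (hM _).trans (by gcongr; exact le_abs_self M)

/-! ### Closed graph, density of the domain, and perturbation of surjectivity. -/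

variable [CompleteSpace H]

/-- If a bounded operator maps `H` into the domain of a densely defined accretive operator `T`,
then composing it with `T` gives a bounded operator. -/
theorem IsAccretive.exists_comp {T : H →ₗ.[ℂ] H} (hT : IsAccretive T)
    (hd : Dense (T.domain : Set H)) (R : H →L[ℂ] H) (hR : ∀ y, R y ∈ T.domain) :
    ∃ N : H →L[ℂ] H, ∀ y, N y = T ⟨R y, hR y⟩ := by
  let N : H →ₗ[ℂ] H := T.toFun ∘ₗ (R : H →ₗ[ℂ] H).codRestrict T.domain hR
  have hN : ∀ y, N y = T ⟨R y, hR y⟩ := fun y => rfl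
  refine ⟨⟨N, N.continuous_of_seq_closed_graph fun u x y hu hy => ?_⟩, hN⟩
  have hx : Tendsto (fun n => R (u n - x)) atTop (𝓝 0) := by
    have := (R.continuous.tendsto 0).comp (tendsto_sub_nhds_zero_iff.mpr hu)
    rwa [map_zero] at this
  have hz : Tendsto (fun n => N (u n - x)) atTop (𝓝 (y - N x)) := by
    simp only [map_sub]
    exact hy.sub_const _
  exact sub_eq_zero.mp (hT.eq_zero_of_tendsto hd (x := fun n => ⟨R (u n - x), hR _⟩) hx hz)

/-- An accretive operator `T` with `R(l + T) = H` is densely defined. -/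
theorem IsAccretive.dense_domain {T : H →ₗ.[ℂ] H} (hT : IsAccretive T) {l : ℝ} (hl : 0 < l)
    (hs : Function.Surjective (shift (l : ℂ) T)) : Dense (T.domain : Set H) := by
  rw [Submodule.dense_iff_topologicalClosure_eq_top, Submodule.topologicalClosure_eq_top_iff,
    Submodule.eq_bot_iff]
  intro y hy
  -- Pairing `l x + T x = y ⊥ D(T)` with `x` gives `Re ⟨T x, x⟩ = -l ‖x‖²`, so `x = 0`.
  obtain ⟨x, hx⟩ : ∃ x : T.domain, (l : ℂ) • (x : H) + T x = y := hs y
  have h0 : inner ℂ y (x : H) = 0 := Submodule.inner_left_of_mem_orthogonal x.2 hy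
  have h1 : inner ℂ (T x) (x : H) =
      -((l : ℂ) * ((‖(x : H)‖ : ℝ) : ℂ) ^ 2) := by
    rw [← hx, inner_add_left, inner_smul_left, Complex.conj_ofReal,
      inner_self_eq_norm_sq_to_K] at h0
    exact eq_neg_of_add_eq_zero_right h0
  have h2 := hT x
  rw [h1, ← Complex.ofReal_pow, ← Complex.ofReal_mul, Complex.neg_re, Complex.ofReal_re] at h2
  have h3 : ‖(x : H)‖ ^ 2 ≤ 0 := by
    by_contra! h
    nlinarith [mul_pos hl h]
  have h4 : (x : H) = 0 := by
    rw [← norm_eq_zero]; nlinarith [norm_nonneg (x : H)]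
  have h5 : x = (0 : T.domain) := Subtype.ext h4
  rw [← hx, h4, h5, T.map_zero, smul_zero, add_zero]

theorem IsAccretive.isMAccretive {T : H →ₗ.[ℂ] H} (hT : IsAccretive T) {l : ℝ} (hl : 0 < l)
    (hs : Function.Surjective (shift (l : ℂ) T)) : IsMAccretive T :=
  ⟨hT, hT.dense_domain hl hs, l, hl, hs⟩

/-- Surjectivity is stable under perturbations of relative bound less than one. -/
theorem surjective_add_of_norm_le {E : Type*} [AddCommGroup E] [Module ℂ E] {L K : E →ₗ[ℂ] H}
    (hL : Function.Surjective L) {q : ℝ} (hq : q < 1) (hK : ∀ x, ‖K x‖ ≤ q * ‖L x‖) :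
    Function.Surjective (L + K) := by
  obtain ⟨G, hG⟩ := L.exists_rightInverse_of_surjective (LinearMap.range_eq_top.mpr hL)
  have hG' : ∀ y, L (G y) = y := fun y => LinearMap.congr_fun hG y
  have hb : ∀ y, ‖(-(K ∘ₗ G)) y‖ ≤ max q 0 * ‖y‖ := by
    intro y
    rw [LinearMap.neg_apply, norm_neg, LinearMap.comp_apply]
    calc ‖K (G y)‖ ≤ q * ‖y‖ := by simpa [hG' y] using hK (G y)
      _ ≤ max q 0 * ‖y‖ := by gcongr; exact le_max_left _ _
  let N : H →L[ℂ] H := (-(K ∘ₗ G)).mkContinuous (max q 0) hb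
  have hN : ‖N‖ < 1 :=
    ((-(K ∘ₗ G)).mkContinuous_norm_le (le_max_right _ _) hb).trans_lt (max_lt hq one_pos)
  -- Neumann series: `(L + K) G = 1 + K G` is invertible.
  obtain ⟨U, hU⟩ := isUnit_one_sub_of_norm_lt_one hN
  intro y
  refine ⟨G ((↑U⁻¹ : H →L[ℂ] H) y), ?_⟩
  have h1 : ((1 - N) * (↑U⁻¹ : H →L[ℂ] H)) y = y := by
    rw [← hU, Units.mul_inv]; rfl
  have h2 : ∀ v, (1 - N) v = v + K (G v) := by
    intro v
    change v - -(K (G v)) = _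
    rw [sub_neg_eq_add]
  rw [LinearMap.add_apply, hG', ← h2]
  exact h1

/-- The method of continuity: `L + K` is surjective if `L` is and `K` is bounded relative to
`L + t K`, uniformly for `t ∈ [0, 1]`. -/
theorem surjective_add_of_forall_norm_le {E : Type*} [AddCommGroup E] [Module ℂ E]
    {L K : E →ₗ[ℂ] H} (hL : Function.Surjective L) {M : ℝ}
    (hK : ∀ t : ℝ, 0 ≤ t → t ≤ 1 → ∀ x, ‖K x‖ ≤ M * ‖L x + (t : ℂ) • K x‖) :
    Function.Surjective (L + K) := by
  -- Steps of length `1 / n` have relative bound `M / n < 1`.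
  obtain ⟨n, hn⟩ := exists_nat_gt (max M 1)
  have hn0 : (0 : ℝ) < n := one_pos.trans ((le_max_right _ _).trans_lt hn)
  have hMn : M < n := (le_max_left _ _).trans_lt hn
  have key : ∀ k : ℕ, k ≤ n →
      Function.Surjective (L + (((k : ℝ) / n : ℝ) : ℂ) • K) := by
    intro k
    induction k with
    | zero => intro _; simpa using hL
    | succ k ih =>
      intro hk
      have hk' : (k : ℝ) ≤ n := by exact_mod_cast (Nat.le_succ k).trans hk
      have h := surjective_add_of_norm_le (ih ((Nat.le_succ k).trans hk))
        (K := ((1 / n : ℝ) : ℂ) • K) (q := M / n) ((div_lt_one hn0).mpr hMn) (by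
          intro x
          rw [LinearMap.smul_apply, norm_smul, Complex.norm_real, Real.norm_of_nonneg (by positivity)]
          have := hK (k / n) (by positivity) ((div_le_one hn0).mpr hk') x
          calc 1 / (n : ℝ) * ‖K x‖ ≤ 1 / n * (M * ‖L x + ((k / n : ℝ) : ℂ) • K x‖) := by gcongr
            _ = _ := by rw [LinearMap.add_apply, LinearMap.smul_apply]; ring)
      rw [add_assoc, ← add_smul, ← Complex.ofReal_add, ← add_div] at h
      rw [Nat.cast_succ]
      exact h
  have h := key n le_rfl
  rwa [div_self hn0.ne', Complex.ofReal_one, one_smul] at h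

/-- For an m-accretive operator `T`, the operator `l + T` is onto for every `l > 0`. -/
theorem IsMAccretive.surjective_shift {T : H →ₗ.[ℂ] H} (hT : IsMAccretive T) {m : ℝ}
    (hm : 0 < m) : Function.Surjective (shift (m : ℂ) T) := by
  obtain ⟨hacc, -, l, hl, hs⟩ := hT
  have hmin : 0 < min l m := lt_min hl hm
  have h := surjective_add_of_forall_norm_le (L := (l : ℂ) • T.domain.subtype + T.toFun)
    (K := ((m - l : ℝ) : ℂ) • T.domain.subtype) (M := |m - l| / min l m) hs (by
      intro t ht0 ht1 x
      have e : ((l : ℂ) • T.domain.subtype + T.toFun) x + (t : ℂ) • (((m - l : ℝ) : ℂ) • T.domain.subtype) x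
          = ((l + t * (m - l) : ℝ) : ℂ) • (x : H) + T x := by
        change ((l : ℂ) • (x : H) + T x) + (t : ℂ) • ((m - l : ℝ) : ℂ) • (x : H) = _
        rw [smul_smul]
        push_cast
        module
      have h1 := mul_norm_le_of_inner_nonneg (hacc x) (l + t * (m - l))
      -- The shift stays between `l` and `m` along the path, so the lower bound is uniform in `t`.
      have h2 : min l m ≤ l + t * (m - l) := by
        nlinarith [min_le_left l m, min_le_right l m]
      have h3 : ‖(((m - l : ℝ) : ℂ) • T.domain.subtype) x‖ = |m - l| * ‖(x : H)‖ := by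
        change ‖((m - l : ℝ) : ℂ) • (x : H)‖ = _
        rw [norm_smul, Complex.norm_real, Real.norm_eq_abs]
      rw [e, h3, div_mul_eq_mul_div, le_div_iff₀ hmin, mul_assoc]
      gcongr
      rw [mul_comm]
      exact (mul_le_mul_of_nonneg_right h2 (norm_nonneg _)).trans h1)
  intro y
  obtain ⟨x, hx⟩ := h y
  refine ⟨x, ?_⟩
  rw [← hx]
  change (m : ℂ) • (x : H) + T x
    = ((l : ℂ) • (x : H) + T x) + ((m - l : ℝ) : ℂ) • (x : H)
  push_cast
  module

/-- The bounded inverse of `1 + T` for an m-accretive operator `T`. -/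
theorem IsMAccretive.exists_resolvent {T : H →ₗ.[ℂ] H} (hT : IsMAccretive T) :
    ∃ R : H →L[ℂ] H, ∃ h : ∀ y, R y ∈ T.domain, (∀ y, R y + T ⟨R y, h y⟩ = y) ∧
      ∀ x : T.domain, R (x + T x) = x := by
  have hs := hT.surjective_shift one_pos
  have hlow : ∀ x : T.domain, ‖(x : H)‖ ≤ ‖(x : H) + T x‖ := by
    intro x
    simpa using mul_norm_le_of_inner_nonneg (hT.1 x) 1
  let L : T.domain →ₗ[ℂ] H := T.domain.subtype + T.toFun
  have hL : ∀ x : T.domain, L x = x + T x := fun x => rfl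
  have hLs : Function.Surjective L := by
    intro y
    obtain ⟨x, hx⟩ : ∃ x : T.domain, ((1 : ℝ) : ℂ) • (x : H) + T x = y := hs y
    exact ⟨x, by rw [hL, ← hx, Complex.ofReal_one, one_smul]⟩
  obtain ⟨G, hG⟩ := L.exists_rightInverse_of_surjective (LinearMap.range_eq_top.mpr hLs)
  have hG' : ∀ y, (G y : H) + T (G y) = y := fun y => LinearMap.congr_fun hG y
  refine ⟨(T.domain.subtype ∘ₗ G).mkContinuous 1 fun y => ?_, fun y => (G y).2, hG', fun x => ?_⟩
  · rw [one_mul]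
    exact (hlow (G y)).trans_eq (by rw [hG'])
  · change (G (x + T x) : H) = x
    have h := hlow (G (x + T x) - x)
    have e : ((G (x + T x) - x : T.domain) : H) + T (G (x + T x) - x) = 0 := by
      have := hG' (x + T x)
      rw [T.map_sub, Submodule.coe_sub, sub_add_sub_comm, this, sub_self]
    rw [e, norm_zero, Submodule.coe_sub] at h
    exact sub_eq_zero.mp (norm_le_zero_iff.mp h)

/-- An accretive operator defined on the domain of an m-accretive operator is relatively
bounded. -/
theorem IsMAccretive.exists_norm_le {A C : H →ₗ.[ℂ] H} (hA : IsMAccretive A) (hC : IsAccretive C)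
    (hAC : A.domain ≤ C.domain) :
    ∃ M : ℝ, 0 ≤ M ∧ ∀ x : A.domain, ‖C ⟨x, hAC x.2⟩‖ ≤ M * (‖(x : H)‖ + ‖A x‖) := by
  obtain ⟨R, hR, -, hRl⟩ := hA.exists_resolvent
  obtain ⟨N, hN⟩ := hC.exists_comp (hA.2.1.mono hAC) R fun y => hAC (hR y)
  refine ⟨‖N‖, norm_nonneg _, fun x => ?_⟩
  have h1 : N (x + A x) = C ⟨x, hAC x.2⟩ := by
    rw [hN]; congr 1; exact Subtype.ext (hRl x)
  rw [← h1]
  exact (N.le_opNorm _).trans (by gcongr; exact norm_add_le _ _)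

/-- A perturbation theorem for an m-accretive operator `A` and an accretive operator `C`
for which `Re ⟨A x, C x⟩` is not too negative. -/
theorem IsMAccretive.add_of_inner_ge {A C : H →ₗ.[ℂ] H} (hA : IsMAccretive A)
    (hC : IsAccretive C) (hAC : A.domain ≤ C.domain) {α β δ : ℝ} (hα : 0 ≤ α)
    (hβ : β < 1) (hδ : 0 ≤ δ)
    (h : ∀ x : A.domain, - α * ‖(x : H)‖ ^ 2 - β * ‖A x‖ ^ 2 - δ * ‖A x‖ * ‖(x : H)‖
      ≤ (inner ℂ (A x) (C ⟨x, hAC x.2⟩)).re) (hβ0 : 0 ≤ β) :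
    IsMAccretive (A + C) := by
  obtain ⟨M, hM0, hM⟩ := hA.exists_norm_le hC hAC
  let K : A.domain →ₗ[ℂ] H := C.toFun ∘ₗ Submodule.inclusion hAC
  have hK : ∀ x : A.domain, K x = C ⟨x, hAC x.2⟩ := fun x => rfl
  -- With `n = ‖x + Ax + tCx‖`, this is the constant in `‖Ax‖ ≤ c n`, from `le_of_sq_le` with `v =
  -- (2 + δ) n` and `w = α`.
  set c : ℝ := (1 + α) / (1 - β) * (2 + δ) + (2 + δ) with hc
  have hsurj := surjective_add_of_forall_norm_le (L := ((1 : ℝ) : ℂ) • A.domain.subtype + A.toFun)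
    (K := K) (M := M * (1 + c)) (hA.surjective_shift one_pos) (by
      intro t ht0 ht1 x
      change ‖K x‖ ≤ M * (1 + c) * ‖(((1 : ℝ) : ℂ) • (x : H) + A x) + (t : ℂ) • K x‖
      set v : H := (x : H) with hv
      have hacc : 0 ≤ (inner ℂ (A x + (t : ℂ) • K x) v).re := by
        rw [inner_add_left, inner_smul_left, Complex.conj_ofReal, Complex.add_re,
          Complex.re_ofReal_mul]
        exact add_nonneg (hA.1 x) (mul_nonneg ht0 (hC ⟨x, hAC x.2⟩))
      have h1 := mul_norm_le_of_inner_nonneg hacc 1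
      rw [← add_assoc, one_mul] at h1
      set n := ‖((1 : ℝ) : ℂ) • v + A x + (t : ℂ) • K x‖ with hn
      have hn0 : 0 ≤ n := norm_nonneg _
      have h2 : ‖A x + (t : ℂ) • K x‖ ≤ 2 * n := by
        have e : A x + (t : ℂ) • K x = (((1 : ℝ) : ℂ) • v + A x + (t : ℂ) • K x) - v := by
          push_cast; module
        rw [e]
        exact (norm_sub_le _ _).trans (by linarith)
      have h3 := h x
      rw [← hK] at h3
      have h4 : (inner ℂ (A x) (A x + (t : ℂ) • K x)).re ≤ ‖A x‖ * (2 * n) :=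
        ((Complex.re_le_norm _).trans (norm_inner_le_norm (𝕜 := ℂ) _ _)).trans (by gcongr)
      have h5 : (inner ℂ (A x) (A x)).re = ‖A x‖ ^ 2 :=
        (norm_sq_eq_re_inner (𝕜 := ℂ) (A x)).symm
      rw [inner_add_right, inner_smul_right, Complex.add_re, Complex.re_ofReal_mul, h5] at h4
      have h6 : (1 - β) * ‖A x‖ ^ 2 ≤ ‖A x‖ * ((2 + δ) * n) + α * ((2 + δ) * n) ^ 2 := by
        have hX : - (α * n ^ 2 + β * ‖A x‖ ^ 2 + δ * ‖A x‖ * n) ≤ (inner ℂ (A x) (K x)).re := by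
          refine le_trans ?_ h3
          have e1 : α * ‖v‖ ^ 2 ≤ α * n ^ 2 := by gcongr
          have e2 : δ * ‖A x‖ * ‖v‖ ≤ δ * ‖A x‖ * n := by gcongr
          linarith
        have hP : 0 ≤ α * n ^ 2 + β * ‖A x‖ ^ 2 + δ * ‖A x‖ * n := by positivity
        have hY : - (α * n ^ 2 + β * ‖A x‖ ^ 2 + δ * ‖A x‖ * n)
            ≤ t * (inner ℂ (A x) (K x)).re := by nlinarith
        have hZ : α * n ^ 2 ≤ α * ((2 + δ) * n) ^ 2 := by
          gcongr
          nlinarith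
        linarith
      have h7 := le_of_sq_le (norm_nonneg _) (by positivity) hα hβ h6
      have h8 := hM x
      rw [← hK] at h8
      have h9 : ‖v‖ + ‖A x‖ ≤ (1 + c) * n := by
        rw [hc]; linarith
      rw [mul_assoc]
      exact h8.trans (by gcongr))
  refine (hA.1.add hC).isMAccretive one_pos fun y => ?_
  obtain ⟨x, hx⟩ := hsurj y
  refine ⟨⟨(x : A.domain), (x : A.domain).2, hAC (x : A.domain).2⟩, ?_⟩
  rw [← hx]
  exact (add_assoc _ _ _).symm

theorem CondC1.isMAccretive {B C : H →ₗ.[ℂ] H} (hB : IsMAccretive (sq B)) (hC : IsAccretive C)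
    (h : CondC1 B C) : IsMAccretive (sq B + C) := by
  obtain ⟨hBC, α, β, δ, hα, hβ0, hβ, hδ, h⟩ := h
  exact hB.add_of_inner_ge hC hBC hα hβ hδ h hβ0

/-- If `B` and `C` are accretive, `B²` is m-accretive and `D(B) ⊆ D(C)`, then `C` is `B`-bounded,
because `(B + i)⁻¹ = (B - i) (1 + B²)⁻¹`. -/
theorem IsAccretive.exists_norm_le {B C : H →ₗ.[ℂ] H} (hB : IsAccretive B)
    (hB2 : IsMAccretive (sq B)) (hC : IsAccretive C) (hBC : B.domain ≤ C.domain) :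
    ∃ M : ℝ, 0 ≤ M ∧ ∀ x : B.domain, ‖C ⟨x, hBC x.2⟩‖ ≤ M * (‖(x : H)‖ + ‖B x‖) := by
  obtain ⟨R, hR, hRr, hRl⟩ := hB2.exists_resolvent
  have hdB : Dense (B.domain : Set H) := hB2.2.1.mono (sq_domain_le B)
  have hdC : Dense (C.domain : Set H) := hdB.mono hBC
  obtain ⟨N, hN⟩ := hB.exists_comp hdB R fun y => (hR y).1
  obtain ⟨P, hP⟩ := hC.exists_comp hdC
    (N - Complex.I • R) fun y => by
      refine hBC (B.domain.sub_mem ?_ (B.domain.smul_mem _ (hR y).1))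
      exact (hN y).symm ▸ (hR y).2
  refine ⟨‖P‖, norm_nonneg _, fun x => ?_⟩
  -- The defect `v` satisfies `Bv = -iv`, hence `v ∈ D(B²)` and `v + B²v = 0`; injectivity of `1 +
  -- B²` gives `v = 0`.
  have key : (N - Complex.I • R) (B x + Complex.I • (x : H)) = x := by
    set y := B x + Complex.I • (x : H) with hy
    set u : B.domain := ⟨R y, (hR y).1⟩ with hu
    set w : B.domain := ⟨B u, (hR y).2⟩ with hw
    have hyu : (u : H) + B w = y := hRr y
    set v : B.domain := w - Complex.I • u - x with hv
    have hBv : B v = -(Complex.I • (v : H)) := by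
      have hvc : (v : H) = B u - Complex.I • (u : H) - x := rfl
      rw [hvc, hv, B.map_sub, B.map_sub, B.map_smul, eq_sub_of_add_eq' hyu, hy, smul_sub, smul_sub,
        smul_smul, Complex.I_mul_I]
      module
    have hBvd : B v ∈ B.domain := by
      rw [hBv]; exact B.domain.neg_mem (B.domain.smul_mem _ v.2)
    have hsq : sq B ⟨v, v.2, hBvd⟩ = -(v : H) := by
      change B ⟨B v, hBvd⟩ = _
      have e : (⟨B v, hBvd⟩ : B.domain) = -(Complex.I • v) := Subtype.ext hBv
      rw [e, B.map_neg, B.map_smul, hBv, smul_neg, smul_smul, Complex.I_mul_I]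
      module
    have h0 := hRl ⟨v, v.2, hBvd⟩
    rw [hsq] at h0
    simp only [add_neg_cancel, map_zero] at h0
    have h1 : B u - Complex.I • (u : H) - x = 0 := h0.symm
    change N y - Complex.I • R y = x
    rw [hN]
    exact sub_eq_zero.mp h1
  have h1 : P (B x + Complex.I • (x : H)) = C ⟨x, hBC x.2⟩ := by
    rw [hP]; congr 1; exact Subtype.ext key
  rw [← h1]
  refine (P.le_opNorm _).trans ?_
  gcongr
  refine (norm_add_le _ _).trans_eq ?_
  rw [norm_smul, Complex.norm_I, one_mul, add_comm]

/-- `C` is `B`-bounded and `B` has `B²`-bound zero, so `C` has arbitrarily small `B²`-bound. -/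
theorem CondC4.condC1 {B C : H →ₗ.[ℂ] H} (hB : IsMAccretive (sq B)) (hC : IsAccretive C)
    (h : CondC4 B C) : CondC1 B C := by
  obtain ⟨hBa, hBC⟩ := h
  obtain ⟨M, hM0, hM⟩ := hBa.exists_norm_le hB hC hBC
  -- The choice `s = 2M + 1` gives `M / s ≤ 1 / 2` and stays positive when `M = 0`.
  have hs : 0 < 2 * M + 1 := by linarith
  refine condC1_of_norm_le ((sq_domain_le B).trans hBC) (β := 1 / 2)
    (δ := M * (1 + (2 * M + 1))) (by norm_num) (by norm_num) (by positivity) fun x => ?_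
  have h1 := hM ⟨x, x.2.1⟩
  have h2 := hBa.mul_norm_le hB.1 hs x
  have h3 : M * ‖B ⟨x, x.2.1⟩‖ ≤ 1 / 2 * ‖sq B x‖ + M * (2 * M + 1) * ‖(x : H)‖ := by
    have h4 := mul_le_mul_of_nonneg_left h2 hM0
    have h5 : M * ‖sq B x‖ ≤ (2 * M + 1) * (1 / 2 * ‖sq B x‖) := by
      nlinarith [norm_nonneg (sq B x)]
    refine le_of_mul_le_mul_left ?_ hs
    nlinarith
  refine h1.trans ?_
  change M * (‖(x : H)‖ + ‖B ⟨x, x.2.1⟩‖) ≤ _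
  nlinarith

theorem CondC3.isMAccretive {B C : H →ₗ.[ℂ] H} (hB : IsAccretive (sq B)) (hC : IsAccretive C)
    (h : CondC3 B C) : IsMAccretive (sq B + C) := by
  obtain ⟨t, ht, R, hR, -⟩ := h
  have hker : (shift (t : ℂ) (sq B)).toFun.ker = ⊥ := by
    rw [LinearMap.ker_eq_bot']
    intro x hx
    have h1 := mul_norm_le_of_inner_nonneg (hB x) t
    have h2 : ‖(t : ℂ) • ((x : (sq B).domain) : H) + sq B x‖ = 0 := norm_eq_zero.mpr hx
    rw [h2] at h1
    have h3 : ‖((x : (sq B).domain) : H)‖ ≤ 0 := nonpos_of_mul_nonpos_right h1 ht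
    exact Subtype.ext (norm_le_zero_iff.mp h3)
  refine (hB.add hC).isMAccretive ht fun y => ?_
  -- The solution is `x = (B² + t)⁻¹ R y`; the natural domain of the product ensures `x ∈ D(C)`.
  obtain ⟨⟨hz, hzC⟩, hy⟩ := hR y
  have hz' := hz
  rw [LinearPMap.inverse_domain] at hz'
  obtain ⟨x, hx⟩ := hz'
  have hinv : (shift (t : ℂ) (sq B)).inverse ⟨R y, hz⟩ = x :=
    LinearPMap.inverse_apply_eq hker hx
  have hxC : ((x : (sq B).domain) : H) ∈ C.domain := by rw [← hinv]; exact hzC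
  refine ⟨⟨(x : (sq B).domain), (x : (sq B).domain).2, hxC⟩, ?_⟩
  have hC' : C ⟨(shift (t : ℂ) (sq B)).inverse ⟨R y, hz⟩, hzC⟩ = C ⟨x, hxC⟩ := by
    congr 1; exact Subtype.ext hinv
  change (1 : ℂ) • R y + C ⟨(shift (t : ℂ) (sq B)).inverse ⟨R y, hz⟩, hzC⟩ = y at hy
  change (t : ℂ) • ((x : (sq B).domain) : H) + sq B x = R y at hx
  rw [hC', one_smul, ← hx, add_assoc] at hy
  exact hy

end AccretivePencil

theorem proposition3p1 {H : Type*} [NormedAddCommGroup H] [InnerProductSpace ℂ H]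
    [CompleteSpace H] (B C : H →ₗ.[ℂ] H)
    (hB : AccretivePencil.IsMAccretive (AccretivePencil.sq B))
    (hC : AccretivePencil.IsAccretive C)
    (hBC : AccretivePencil.CondC1 B C ∨ AccretivePencil.CondC2 B C ∨
      AccretivePencil.CondC3 B C ∨ AccretivePencil.CondC4 B C ∨ AccretivePencil.CondC5 B C) :
    AccretivePencil.IsMAccretive (AccretivePencil.sq B + C) ∧
      ((AccretivePencil.CondC1 B C ∨ AccretivePencil.CondC2 B C ∨
          AccretivePencil.CondC4 B C ∨ AccretivePencil.CondC5 B C ∨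
          (AccretivePencil.sq B).domain ≤ C.domain) →
        (AccretivePencil.sq B + C).domain = (AccretivePencil.sq B).domain) := by
  refine ⟨?_, fun h => ?_⟩
  · rcases hBC with h | h | h | h | h
    · exact h.isMAccretive hB hC
    · exact h.condC1.isMAccretive hB hC
    · exact h.isMAccretive hB.1 hC
    · exact (h.condC1 hB hC).isMAccretive hB hC
    · exact h.condC1.isMAccretive hB hC
  · have hle : (AccretivePencil.sq B).domain ≤ C.domain := by
      rcases h with h | h | h | h | h
      · exact h.1
      · exact h.1
      · exact (AccretivePencil.sq_domain_le B).trans h.2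
      · exact h.2.1 ▸ le_top
      · exact h
    exact inf_eq_left.mpr hle
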